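/- **Online stochastic matching.** Let $G=(Y,Z,E)$ be a finite bipartite graph with ball types $Y$ and bins $Z$, and let $r_y\ge 0$ $(y\in Y)$ be rates with $\sum_{y\in Y} r_y=b$, where $b$ is a positive integer. At each time $t=1,\dots,b$ a ball of type $y$ arrives with probability $r_y/b$, independently of the other times; upon arrival it may be placed in at most one empty bin adjacent to its type. For every sequence $\omega=(y_1,\dots,y_b)$ of arrivals fix a maximum matching of the arrived balls to adjacent bins, let $\mathrm{OPT}(\omega)$ be its size, and for $e=(y,z)\in E$ let $f_e$ be the probability that this matching puts some ball of type $y$ into bin $z$. **The adaptive algorithm.** For each $y\in Y$ let $(y,z_1),\dots,(y,z_k)$ be the edges at $y$, ordered so that $f_{(y,z_1)}\ge\dots\ge f_{(y,z_k)}$ (ties are broken arbitrarily), and write $f_j=f_{(y,z_j)}$. Put $$I_{(y,z_l)}=\Big[\sum_{j<l}f_j,\ \sum_{j\le l}f_j\Big)\quad(1\le l\le k),$$ $$J_{(y,z_1)}=[\,r_y-f_1,\ r_y),\qquad J_{(y,z_l)}=\Big[\sum_{2\le j<l}f_j,\ \sum_{2\le j\le l}f_j\Big)\quad(2\le l\le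 k),$$ and assign the rest of $[0,r_y]$ in either partition to a dummy bin, which never accepts a ball (it counts as full). When a ball of type $y$ arrives, the algorithm draws $x$ uniformly from $[0,r_y]$, independently of everything else. Let $z$ and $z'$ be the (possibly dummy) bins with $x\in I_{(y,z)}$ and $x\in J_{(y,z')}$. The ball is placed in $z$ if $z$ is an empty bin; otherwise it is placed in $z'$ if $z'$ is an empty bin; otherwise it is dropped. Let $\mathrm{ALG}$ be the number of bins filled at the end. **Corollary.** There is an absolute constant $b_0$ such that for every $b\ge b_0$ and every instance as above in which all rates $r_y$ are integers (and $\mathbb E[\mathrm{OPT}]>0$), for every choice of the maximum matchings and every tie-breaking, the competitive ratio of this algorithm satisfies $$\frac{\mathbb E[\mathrm{ALG}]}{\mathbb E[\mathrm{OPT}]}\ \ge\ 0.705 .$$ -/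

import Mathlib

open scoped ProbabilityTheory

noncomputable section

/-- An instance of the online stochastic matching problem with `b` arrivals: a bipartite graph
between ball types `Y` and bins `Z`, and nonnegative arrival rates of the ball types, which are
normalized to have sum `b`. -/
structure StochasticMatching (Y Z : Type*) [Fintype Y] (b : ℕ) where
  adj : Y → Z → Prop
  rate : Y → ℝ
  rate_nonneg : ∀ y, 0 ≤ rate y
  sum_rate : ∑ y, rate y = b

namespace StochasticMatching

variable {Y Z : Type*} [Fintype Y] [Fintype Z] {b : ℕ} (G : StochasticMatching Y Z b)

/-- Probability of the sequence `ω` of arriving balls: the balls are independent, and each one has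
type `y` with probability proportional to `rate y`. -/
def prob (ω : Fin b → Y) : ℝ := ∏ t, G.rate (ω t) / ∑ y, G.rate y

/-- `a` allocates the balls of the sequence `ω` to adjacent bins (`none`: the ball is dropped),
and each bin receives at most one ball. -/
def IsMatching (ω : Fin b → Y) (a : Fin b → Option Z) : Prop :=
  (∀ t z, a t = some z → G.adj (ω t) z) ∧
    ∀ s t z, a s = some z → a t = some z → s = t

/-- The number of allocated balls. -/
def size (a : Fin b → Option Z) : ℕ := (Finset.univ.filter fun t => (a t).isSome = true).card

def IsMaximumMatching (ω : Fin b → Y) (a : Fin b → Option Z) : Prop :=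
  G.IsMatching ω a ∧ ∀ a', G.IsMatching ω a' → size a' ≤ size a

/-- A maximum matching algorithm: a choice of a maximum matching for every sequence of balls. -/
structure OfflineOpt where
  alloc : (Fin b → Y) → Fin b → Option Z
  isMaximum : ∀ ω, G.IsMaximumMatching ω (alloc ω)

variable {G}

namespace OfflineOpt

variable (M : G.OfflineOpt)

/-- Expected value of the offline optimum. -/
def expectedOpt : ℝ := ∑ ω : Fin b → Y, G.prob ω * size (M.alloc ω)

open Classical in
/-- The indicator of the event that the offline optimum uses the edge `(y, z)` on `ω`. -/
def used (ω : Fin b → Y) (y : Y) (z : Z) : ℝ :=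
  if ∃ t, ω t = y ∧ M.alloc ω t = some z then 1 else 0

/-- The fractional matching `f` defined by the offline optimum. -/
def frac (y : Y) (z : Z) : ℝ := ∑ ω : Fin b → Y, G.prob ω * M.used ω y z

/-- For every ball type `y`, an enumeration of the edges `(y, z₀), (y, z₁), …` at `y`
in an order of nonincreasing `f`; ties are broken in an arbitrary way. -/
structure EdgeOrder where
  deg : Y → ℕ
  nbr : ∀ y, Fin (deg y) ≃ {z : Z // G.adj y z}
  antitone : ∀ y, Antitone fun i => M.frac y (nbr y i)

namespace EdgeOrder

variable {M} (σ : M.EdgeOrder)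

/-- The value of `f` on the `i`-th edge at `y`. -/
def val (y : Y) (i : Fin (σ.deg y)) : ℝ := M.frac y (σ.nbr y i)

/-- The part of `[0, rate y]` that the first partition gives to the `i`-th edge at `y`:
consecutive intervals of lengths `val y 0, val y 1, …`. The rest of `[0, rate y]` belongs to the
dummy edge. Intervals are half-open, so that the parts are disjoint. -/
def firstPart (y : Y) (i : Fin (σ.deg y)) : Set ℝ :=
  Set.Ico (∑ j with j < i, σ.val y j) (∑ j with j ≤ i, σ.val y j)

/-- The part of `[0, rate y]` that the second partition gives to the `i`-th edge at `y`: the edge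
of largest value is put at the right end of `[0, rate y]`, the others follow each other from `0`
on, and the rest again belongs to the dummy edge. -/
def secondPart (y : Y) (i : Fin (σ.deg y)) : Set ℝ :=
  if i.val = 0 then Set.Ico (G.rate y - σ.val y i) (G.rate y)
  else Set.Ico (∑ j with 0 < j.val ∧ j < i, σ.val y j) (∑ j with 0 < j.val ∧ j ≤ i, σ.val y j)

open Classical in
/-- First priority bin of a ball of type `y` with random number `x`; `none` is the dummy bin. -/
def first (y : Y) (x : ℝ) : Option Z :=
  if h : ∃ i, x ∈ σ.firstPart y i then some (σ.nbr y h.choose : Z) else none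

open Classical in
/-- Second priority bin of a ball of type `y` with random number `x`; `none` is the dummy bin. -/
def second (y : Y) (x : ℝ) : Option Z :=
  if h : ∃ i, x ∈ σ.secondPart y i then some (σ.nbr y h.choose : Z) else none

open Classical in
/-- Arrival of a ball of type `y` with random number `x` when the set of full bins is `S`: the ball
goes to the first priority bin if this is an empty bin, otherwise to the second priority bin if
this is an empty bin, and otherwise it is dropped. The dummy bin never takes a ball. -/
def step (S : Finset Z) (y : Y) (x : ℝ) : Finset Z :=
  if ∃ z, σ.first y x = some z ∧ z ∉ S then S ∪ (σ.first y x).toFinset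
  else S ∪ (σ.second y x).toFinset

/-- The set of full bins after the first `t` arrivals, for the ball types `ω` and the random
numbers `x`. -/
def full (ω : Fin b → Y) (x : Fin b → ℝ) : ℕ → Finset Z
  | 0 => ∅
  | t + 1 => if h : t < b then σ.step (full ω x t) (ω ⟨t, h⟩) (x ⟨t, h⟩) else full ω x t

/-- Expected number of bins filled by the online algorithm: given the ball types `ω`, the number
of the `t`-th ball is drawn uniformly from `[0, rate (ω t)]`, independently over `t`. -/
def expectedAlg : ℝ :=
  ∑ ω : Fin b → Y, G.prob ω *
    ∫ x, ((σ.full ω x b).card : ℝ)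
      ∂MeasureTheory.Measure.pi fun t =>
        ProbabilityTheory.cond MeasureTheory.volume (Set.Icc 0 (G.rate (ω t)))

/-- The competitive ratio of the online algorithm. -/
def competitiveRatio : ℝ := σ.expectedAlg / M.expectedOpt

end EdgeOrder

end OfflineOpt

end StochasticMatching

end

/-! Let a(z) be the `load` of a bin, λ(z', z) the rate of balls with priorities (z', z), and s(z) =
λ(z, z). Both partitions give every edge an interval of length f, so both marginals of λ at z are
a(z).

The set of full bins is a Markov chain. An empty bin z is filled at rate 2a(z) - s(z), except that a
ball with priorities (z', z), z' ≠ z, does not reach z while z' is empty. First priorities alone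
show that z and z' are both empty after t balls with probability at most (1 - (a(z) + a(z'))/b)^t.
Solving the resulting recursion (`stateExp_empty_le`) and using convexity of exp (`geom_sum_le`)
gives, up to O(1/b), P(z empty) ≤ X + ∑_{z' ≠ z} λ(z', z) (X + exp(-a(z) - a(z')))/2, where X =
exp(-(2a(z) - s(z))).

The bins are decoupled by bounding the last exponential by a function linear in a(z')
(`exp_add_le_linear`): its part depending on z' is charged to z' through the other marginal of λ. An
inequality in a and s for a single bin remains (`bin_bound`).

Integrality controls s. The two intervals of an edge overlap in length at most max(0, 2f - r), and f
≤ 1, f ≤ r leave only r = 1. An edge is used only if its type arrives, so f ≤ 1 - (1 - 1/b)^b. Hence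
s is at most about 1 - 2/e, and s > 0 forces a ≥ 1/2. -/

noncomputable section

namespace StochasticMatching

variable {Y Z : Type*} [Fintype Y] [Fintype Z] {b : ℕ} {G : StochasticMatching Y Z b}

/-! ### Expectations over the arrival sequence -/

omit [Fintype Z] in
theorem prob_nonneg (ω : Fin b → Y) : 0 ≤ G.prob ω :=
  Finset.prod_nonneg fun _ _ => div_nonneg (G.rate_nonneg _)
    (Finset.sum_nonneg fun y _ => G.rate_nonneg y)

omit [Fintype Z] in
theorem sum_rate_div (hb : 0 < b) : ∑ y, G.rate y / ∑ y, G.rate y = 1 := by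
  rw [← Finset.sum_div, G.sum_rate, div_self]
  positivity

omit [Fintype Z] in
/-- Expectation of a product of functions of the individual arrivals. -/
theorem sum_prob_mul_prod (h : Fin b → Y → ℝ) :
    ∑ ω : Fin b → Y, G.prob ω * ∏ t, h t (ω t) = ∏ t, ∑ y, G.rate y / b * h t y := by
  classical
  rw [Finset.prod_univ_sum, Fintype.piFinset_univ]
  refine Finset.sum_congr rfl fun ω _ => ?_
  rw [prob, ← Finset.prod_mul_distrib, G.sum_rate]

omit [Fintype Z] in
theorem sum_prob (hb : 0 < b) : ∑ ω : Fin b → Y, G.prob ω = 1 := by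
  have h := sum_prob_mul_prod (G := G) fun _ _ => 1
  have h2 := sum_rate_div (G := G) hb
  rw [G.sum_rate] at h2
  simpa [h2] using h

omit [Fintype Z] in
open Classical in
/-- Probability that a given ball has type `y`. -/
theorem sum_prob_apply_eq (hb : 0 < b) (t : Fin b) (y : Y) :
    ∑ ω : Fin b → Y, G.prob ω * (if ω t = y then 1 else 0) = G.rate y / b := by
  have h := sum_prob_mul_prod (G := G) fun s y' => if s = t then if y' = y then 1 else 0 else 1
  have h2 := sum_rate_div (G := G) hb
  rw [G.sum_rate] at h2
  have h3 : ∀ s, ∑ y', G.rate y' / b * (if s = t then if y' = y then 1 else 0 else 1)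
      = if s = t then G.rate y / b else 1 := by
    intro s
    by_cases hs : s = t <;> simp [hs, h2]
  simp_rw [h3] at h
  simpa using h

omit [Fintype Z] in
open Classical in
/-- Probability that no ball has type `y`. -/
theorem sum_prob_forall_ne (hb : 0 < b) (y : Y) :
    ∑ ω : Fin b → Y, G.prob ω * (if ∃ t, ω t = y then 0 else 1) = (1 - G.rate y / b) ^ b := by
  have h := sum_prob_mul_prod (G := G) fun _ y' => if y' = y then 0 else 1
  have h2 := sum_rate_div (G := G) hb
  rw [G.sum_rate] at h2
  have h3 : ∑ y', G.rate y' / b * (if y' = y then 0 else 1) = 1 - G.rate y / b := by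
    have h4 : ∀ y', G.rate y' / b * (if y' = y then 0 else 1)
        = G.rate y' / b - if y' = y then G.rate y' / b else 0 := by
      intro y'
      split_ifs <;> ring
    simp_rw [h4, Finset.sum_sub_distrib, h2]
    simp
  simp only [h3, Finset.prod_const, Finset.card_univ, Fintype.card_fin] at h
  rw [← h]
  refine Finset.sum_congr rfl fun ω _ => ?_
  congr 1
  split_ifs with h4
  · obtain ⟨t, ht⟩ := h4
    exact (Finset.prod_eq_zero (f := fun t => if ω t = y then (0 : ℝ) else 1)
      (Finset.mem_univ t) (if_pos ht)).symm
  · push Not at h4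
    exact (Finset.prod_eq_one fun t _ => if_neg (h4 t)).symm

/-! ### The fractional matching of the offline optimum -/

namespace OfflineOpt

variable (M : G.OfflineOpt)

omit [Fintype Z] in
theorem used_nonneg (ω : Fin b → Y) (y : Y) (z : Z) : 0 ≤ M.used ω y z := by
  unfold used; split_ifs <;> norm_num

omit [Fintype Z] in
theorem frac_nonneg (y : Y) (z : Z) : 0 ≤ M.frac y z :=
  Finset.sum_nonneg fun ω _ => mul_nonneg (prob_nonneg ω) (M.used_nonneg ω y z)

omit [Fintype Z] in
theorem frac_eq_zero_of_not_adj {y : Y} {z : Z} (h : ¬ G.adj y z) : M.frac y z = 0 := by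
  refine Finset.sum_eq_zero fun ω _ => ?_
  rw [used, if_neg, mul_zero]
  rintro ⟨t, rfl, ht⟩
  exact h ((M.isMaximum ω).1.1 t z ht)

omit [Fintype Z] in
open Classical in
/-- Edges used by the offline optimum correspond to allocated balls. -/
theorem used_eq_sum (ω : Fin b → Y) (y : Y) (z : Z) :
    M.used ω y z = ∑ t, if ω t = y ∧ M.alloc ω t = some z then 1 else 0 := by
  rw [used]
  split_ifs with h
  · obtain ⟨t, ht⟩ := h
    rw [Finset.sum_eq_single t, if_pos ht]
    · intro s _ hs
      exact if_neg fun h => hs ((M.isMaximum ω).1.2 s t z h.2 ht.2)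
    · simp
  · push Not at h
    exact (Finset.sum_eq_zero fun t _ => if_neg fun h' => h t h'.1 h'.2).symm

omit [Fintype Z] in
theorem sum_used_le_one (ω : Fin b → Y) (z : Z) : ∑ y, M.used ω y z ≤ 1 := by
  classical
  simp_rw [used_eq_sum]
  rw [Finset.sum_comm]
  simp_rw [ite_and, Finset.sum_ite_eq, Finset.mem_univ, if_true]
  rw [Finset.sum_boole]
  norm_cast
  rw [Finset.card_le_one]
  intro s hs t ht
  simp only [Finset.mem_filter, Finset.mem_univ, true_and] at hs ht
  exact (M.isMaximum ω).1.2 s t z hs ht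

open Classical in
theorem sum_used_le_card (ω : Fin b → Y) (y : Y) :
    ∑ z, M.used ω y z ≤ ∑ t, if ω t = y then 1 else 0 := by
  simp_rw [used_eq_sum]
  rw [Finset.sum_comm]
  refine Finset.sum_le_sum fun t _ => ?_
  by_cases h : ω t = y
  · simp only [h, true_and, if_true]
    rw [Finset.sum_boole]
    norm_cast
    rw [Finset.card_le_one]
    intro z hz z' hz'
    simp only [Finset.mem_filter, Finset.mem_univ, true_and] at hz hz'
    exact Option.some_injective _ (hz.symm.trans hz')
  · simp [h]

theorem size_eq_sum_used (ω : Fin b → Y) :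
    (size (M.alloc ω) : ℝ) = ∑ z, ∑ y, M.used ω y z := by
  classical
  simp_rw [used_eq_sum]
  simp_rw [fun z => Finset.sum_comm (s := (Finset.univ : Finset Y)) (t := (Finset.univ : Finset (Fin b)))
    (f := fun y t => if ω t = y ∧ M.alloc ω t = some z then (1 : ℝ) else 0)]
  simp_rw [ite_and, Finset.sum_ite_eq, Finset.mem_univ, if_true]
  rw [Finset.sum_comm, size, Finset.card_filter]
  push_cast
  refine Finset.sum_congr rfl fun t _ => ?_
  cases h : M.alloc ω t <;> simp

theorem expectedOpt_eq_sum_frac : M.expectedOpt = ∑ z, ∑ y, M.frac y z := by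
  simp_rw [expectedOpt, size_eq_sum_used, frac, Finset.mul_sum]
  rw [Finset.sum_comm]
  refine Finset.sum_congr rfl fun z _ => ?_
  rw [Finset.sum_comm]

omit [Fintype Z] in
theorem sum_frac_le_one (hb : 0 < b) (z : Z) : ∑ y, M.frac y z ≤ 1 := by
  simp_rw [frac]
  rw [Finset.sum_comm, ← sum_prob (G := G) hb]
  refine Finset.sum_le_sum fun ω _ => ?_
  rw [← Finset.mul_sum]
  exact mul_le_of_le_one_right (prob_nonneg ω) (M.sum_used_le_one ω z)

theorem sum_frac_le_rate (hb : 0 < b) (y : Y) : ∑ z, M.frac y z ≤ G.rate y := by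
  classical
  simp_rw [frac]
  rw [Finset.sum_comm]
  calc ∑ ω, ∑ z, G.prob ω * M.used ω y z
      ≤ ∑ ω, G.prob ω * ∑ t, (if ω t = y then 1 else 0) := by
        refine Finset.sum_le_sum fun ω _ => ?_
        rw [← Finset.mul_sum]
        exact mul_le_mul_of_nonneg_left (M.sum_used_le_card ω y) (prob_nonneg ω)
    _ = ∑ t : Fin b, G.rate y / b := by
        simp_rw [Finset.mul_sum]
        rw [Finset.sum_comm]
        exact Finset.sum_congr rfl fun t _ => sum_prob_apply_eq hb t y
    _ = G.rate y := by
        have : (b : ℝ) ≠ 0 := by positivity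
        simp only [Finset.sum_const, Finset.card_univ, Fintype.card_fin, nsmul_eq_mul]
        field_simp

omit [Fintype Z] in
-- An edge at `y` can be used only if some ball of type `y` arrives.
theorem frac_le (hb : 0 < b) (y : Y) (z : Z) : M.frac y z ≤ 1 - (1 - G.rate y / b) ^ b := by
  classical
  rw [← sum_prob_forall_ne hb, frac, le_sub_iff_add_le, ← Finset.sum_add_distrib]
  refine (Finset.sum_le_sum fun ω _ => ?_).trans_eq (sum_prob (G := G) hb)
  rw [used]
  have := prob_nonneg (G := G) ω
  by_cases h : ∃ t, ω t = y
  · rw [if_pos h]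
    split_ifs <;> linarith
  · rw [if_neg h, if_neg]
    · linarith
    · rintro ⟨t, ht, _⟩
      exact h ⟨t, ht⟩

end OfflineOpt

/-! ### The two partitions and the rates of priority pairs -/

namespace OfflineOpt
namespace EdgeOrder

open MeasureTheory

variable {M : G.OfflineOpt} (σ : M.EdgeOrder)

omit [Fintype Z] in
theorem val_nonneg (y : Y) (i : Fin (σ.deg y)) : 0 ≤ σ.val y i := M.frac_nonneg _ _

theorem sum_val (y : Y) : ∑ i, σ.val y i = ∑ z, M.frac y z := by
  classical
  simp_rw [val]
  rw [Equiv.sum_comp (σ.nbr y) (fun z => M.frac y z),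
    ← Finset.sum_subtype (Finset.univ.filter (G.adj y)) (by simp) (M.frac y),
    Finset.sum_filter_of_ne fun z _ h => by
    by_contra h'; exact h (M.frac_eq_zero_of_not_adj h')]

theorem sum_val_le_rate (hb : 0 < b) (y : Y) : ∑ i, σ.val y i ≤ G.rate y :=
  (σ.sum_val y).trans_le (M.sum_frac_le_rate hb y)

omit [Fintype Z] in
theorem sum_val_mono (y : Y) {s t : Finset (Fin (σ.deg y))} (h : s ⊆ t) :
    ∑ i ∈ s, σ.val y i ≤ ∑ i ∈ t, σ.val y i :=
  Finset.sum_le_sum_of_subset_of_nonneg h fun i _ _ => σ.val_nonneg y i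

omit [Fintype Z] in
theorem sum_val_le_eq (y : Y) (i : Fin (σ.deg y)) :
    ∑ j with j ≤ i, σ.val y j = ∑ j with j < i, σ.val y j + σ.val y i := by
  rw [← Finset.sum_filter_add_sum_filter_not (Finset.univ.filter (· ≤ i)) (· < i),
    Finset.filter_filter, Finset.filter_filter]
  congr 1
  · exact Finset.sum_congr (by ext j; simp; exact le_of_lt) fun _ _ => rfl
  · rw [Finset.sum_eq_single i]
    · intro j hj hji
      simp only [Finset.mem_filter, Finset.mem_univ, true_and, not_lt] at hj
      exact absurd (le_antisymm hj.1 hj.2) hji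
    · simp

omit [Fintype Z] in
theorem sum_val_pos_le_eq (y : Y) (i : Fin (σ.deg y)) (hi : i.val ≠ 0) :
    ∑ j with 0 < j.val ∧ j ≤ i, σ.val y j
      = ∑ j with 0 < j.val ∧ j < i, σ.val y j + σ.val y i := by
  rw [← Finset.sum_filter_add_sum_filter_not (Finset.univ.filter fun j => 0 < j.val ∧ j ≤ i) (· < i),
    Finset.filter_filter, Finset.filter_filter]
  congr 1
  · exact Finset.sum_congr (by ext j; simp; intro h _; exact h.le) fun _ _ => rfl
  · rw [Finset.sum_eq_single i]
    · intro j hj hji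
      simp only [Finset.mem_filter, Finset.mem_univ, true_and, not_lt] at hj
      exact absurd (le_antisymm hj.1.2 hj.2) hji
    · simp [Nat.pos_iff_ne_zero, hi]

omit [Fintype Z] in
-- Apart from the edge of largest value, the second partition is the first one translated to the
-- left by that value.
theorem sum_val_le_eq_zero_add (y : Y) (i k : Fin (σ.deg y)) (hk : k.val = 0) :
    ∑ j with j ≤ i, σ.val y j = σ.val y k + ∑ j with 0 < j.val ∧ j ≤ i, σ.val y j := by
  rw [← Finset.sum_filter_add_sum_filter_not (Finset.univ.filter (· ≤ i)) (fun j => j.val = 0),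
    Finset.filter_filter, Finset.filter_filter]
  congr 1
  · rw [Finset.sum_eq_single k]
    · intro j hj hji
      simp only [Finset.mem_filter, Finset.mem_univ, true_and] at hj
      exact absurd (Fin.ext (hj.2.trans hk.symm)) hji
    · simp only [Finset.mem_filter, Finset.mem_univ, true_and, not_and]
      intro h
      exact absurd hk (h (Fin.le_def.2 (hk.trans_le (Nat.zero_le _))))
  · refine Finset.sum_congr ?_ fun _ _ => rfl
    ext j
    simp only [Finset.mem_filter, Finset.mem_univ, true_and, Nat.pos_iff_ne_zero]
    exact and_comm

omit [Fintype Z] in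
theorem firstPart_disjoint (y : Y) {i j : Fin (σ.deg y)} {x : ℝ} (hi : x ∈ σ.firstPart y i)
    (hj : x ∈ σ.firstPart y j) : i = j := by
  have key : ∀ {i j}, x ∈ σ.firstPart y i → x ∈ σ.firstPart y j → ¬ i < j := by
    intro i j hi hj h
    have := σ.sum_val_mono y (s := Finset.univ.filter (· ≤ i)) (t := Finset.univ.filter (· < j))
      (by intro k; simp; exact fun hk => lt_of_le_of_lt hk h)
    exact absurd (hi.2.trans_le this) (not_lt.2 hj.1)
  exact le_antisymm (not_lt.1 (key hj hi)) (not_lt.1 (key hi hj))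

/-- The translated intervals end before the interval of the largest edge begins, which makes the
second partition disjoint. -/
theorem sum_pos_le_rate_sub (hb : 0 < b) (y : Y) (i k : Fin (σ.deg y)) (hk : k.val = 0) :
    ∑ j with 0 < j.val ∧ j ≤ i, σ.val y j ≤ G.rate y - σ.val y k := by
  have h1 := σ.sum_val_le_eq_zero_add y i k hk
  have h2 := σ.sum_val_mono y (Finset.filter_subset (· ≤ i) Finset.univ)
  have h3 := σ.sum_val_le_rate hb y
  linarith

theorem secondPart_disjoint (hb : 0 < b) (y : Y) {i j : Fin (σ.deg y)} {x : ℝ}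
    (hi : x ∈ σ.secondPart y i) (hj : x ∈ σ.secondPart y j) : i = j := by
  have key : ∀ {i j}, x ∈ σ.secondPart y i → x ∈ σ.secondPart y j → ¬ i < j := by
    intro i j hi hj h
    have hj0 : j.val ≠ 0 := by have := Fin.lt_def.1 h; omega
    rw [secondPart, if_neg hj0] at hj
    by_cases hi0 : i.val = 0
    · rw [secondPart, if_pos hi0] at hi
      exact absurd (hj.2.trans_le (σ.sum_pos_le_rate_sub hb y j i hi0)) (not_lt.2 hi.1)
    · rw [secondPart, if_neg hi0] at hi
      have := σ.sum_val_mono y (s := Finset.univ.filter fun k => 0 < k.val ∧ k ≤ i)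
        (t := Finset.univ.filter fun k => 0 < k.val ∧ k < j)
        (by intro k; simp; exact fun h0 hk => ⟨h0, lt_of_le_of_lt hk h⟩)
      exact absurd (hi.2.trans_le this) (not_lt.2 hj.1)
  exact le_antisymm (not_lt.1 (key hj hi)) (not_lt.1 (key hi hj))

omit [Fintype Z] in
theorem first_eq_some_iff (y : Y) (x : ℝ) (z : Z) :
    σ.first y x = some z ↔ ∃ i, (σ.nbr y i : Z) = z ∧ x ∈ σ.firstPart y i := by
  unfold first
  split_ifs with h
  · rw [Option.some_inj]
    refine ⟨fun hz => ⟨_, hz, h.choose_spec⟩, ?_⟩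
    rintro ⟨i, rfl, hi⟩
    rw [σ.firstPart_disjoint y h.choose_spec hi]
  · simp only [false_iff]
    rintro ⟨i, _, hi⟩
    exact h ⟨i, hi⟩

theorem second_eq_some_iff (hb : 0 < b) (y : Y) (x : ℝ) (z : Z) :
    σ.second y x = some z ↔ ∃ i, (σ.nbr y i : Z) = z ∧ x ∈ σ.secondPart y i := by
  unfold second
  split_ifs with h
  · rw [Option.some_inj]
    refine ⟨fun hz => ⟨_, hz, h.choose_spec⟩, ?_⟩
    rintro ⟨i, rfl, hi⟩
    rw [σ.secondPart_disjoint hb y h.choose_spec hi]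
  · simp only [false_iff]
    rintro ⟨i, _, hi⟩
    exact h ⟨i, hi⟩

omit [Fintype Z] in
theorem measurableSet_firstPart (y : Y) (i : Fin (σ.deg y)) : MeasurableSet (σ.firstPart y i) :=
  measurableSet_Ico

omit [Fintype Z] in
theorem measurableSet_secondPart (y : Y) (i : Fin (σ.deg y)) :
    MeasurableSet (σ.secondPart y i) := by
  unfold secondPart; split_ifs <;> exact measurableSet_Ico

theorem measurableSet_first_eq (y : Y) (o : Option Z) : MeasurableSet {x | σ.first y x = o} := by
  have h : ∀ z, MeasurableSet {x | σ.first y x = some z} := fun z => by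
    simp_rw [first_eq_some_iff, Set.ofPred_exists]
    refine MeasurableSet.iUnion fun i => ?_
    by_cases hi : (σ.nbr y i : Z) = z
    · simpa [hi] using σ.measurableSet_firstPart y i
    · simp [hi]
  cases o with
  | some z => exact h z
  | none =>
    have : {x | σ.first y x = none} = (⋃ z, {x | σ.first y x = some z})ᶜ := by
      ext x; simp [Option.eq_none_iff_forall_ne_some]
    rw [this]
    exact (MeasurableSet.iUnion h).compl

theorem measurableSet_second_eq (hb : 0 < b) (y : Y) (o : Option Z) :
    MeasurableSet {x | σ.second y x = o} := by
  have h : ∀ z, MeasurableSet {x | σ.second y x = some z} := fun z => by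
    simp_rw [σ.second_eq_some_iff hb, Set.ofPred_exists]
    refine MeasurableSet.iUnion fun i => ?_
    by_cases hi : (σ.nbr y i : Z) = z
    · simpa [hi] using σ.measurableSet_secondPart y i
    · simp [hi]
  cases o with
  | some z => exact h z
  | none =>
    have : {x | σ.second y x = none} = (⋃ z, {x | σ.second y x = some z})ᶜ := by
      ext x; simp [Option.eq_none_iff_forall_ne_some]
    rw [this]
    exact (MeasurableSet.iUnion h).compl

/-- Rate of arrival of balls of type `y` with first priority `p.1` and second priority `p.2`. -/
def pairRate (y : Y) (p : Option Z × Option Z) : ℝ :=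
  volume.real {x ∈ Set.Icc 0 (G.rate y) | (σ.first y x, σ.second y x) = p}

omit [Fintype Z] in
theorem pairRate_nonneg (y : Y) (p : Option Z × Option Z) : 0 ≤ σ.pairRate y p :=
  measureReal_nonneg

theorem measurableSet_pair_eq (hb : 0 < b) (y : Y) (p : Option Z × Option Z) :
    MeasurableSet {x | (σ.first y x, σ.second y x) = p} := by
  simp_rw [Prod.ext_iff]
  exact (σ.measurableSet_first_eq y p.1).inter (σ.measurableSet_second_eq hb y p.2)

/-- Integration of a function of the two priorities. -/
theorem integral_pair (hb : 0 < b) (y : Y) (φ : Option Z × Option Z → ℝ) :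
    ∫ x in Set.Icc 0 (G.rate y), φ (σ.first y x, σ.second y x)
      = ∑ p, σ.pairRate y p * φ p := by
  classical
  have h : ∀ x, φ (σ.first y x, σ.second y x)
      = ∑ p, Set.indicator {x | (σ.first y x, σ.second y x) = p} (fun _ => φ p) x := by
    intro x
    simp [Set.indicator_apply]
  simp_rw [h]
  rw [integral_finsetSum]
  · refine Finset.sum_congr rfl fun p _ => ?_
    rw [integral_indicator_const _ (σ.measurableSet_pair_eq hb y p), smul_eq_mul, pairRate,
      measureReal_restrict_apply (σ.measurableSet_pair_eq hb y p)]
    congr 2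
    ext x
    exact and_comm
  · intro p _
    exact (integrable_const _).indicator (σ.measurableSet_pair_eq hb y p)

theorem sum_pairRate (hb : 0 < b) (y : Y) : ∑ p, σ.pairRate y p = G.rate y := by
  have h := σ.integral_pair hb y fun _ => 1
  simpa [G.rate_nonneg y] using h.symm

/-- The interval of an edge has length f and lies inside `[0, rate y]`, because the values at `y`
add up to at most the rate. -/
theorem sum_pairRate_first (hb : 0 < b) (y : Y) (z : Z) :
    ∑ o, σ.pairRate y (some z, o) = M.frac y z := by
  classical
  have h := σ.integral_pair hb y fun p => if p.1 = some z then 1 else 0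
  rw [Fintype.sum_prod_type, Finset.sum_eq_single (some z)] at h
  · simp only [if_true, mul_one] at h
    rw [← h]
    have h2 : (fun x => if σ.first y x = some z then (1 : ℝ) else 0)
        = Set.indicator {x | σ.first y x = some z} fun _ => 1 := by
      ext x; simp [Set.indicator_apply]
    rw [h2, integral_indicator_const _ (σ.measurableSet_first_eq y _), smul_eq_mul, mul_one,
      measureReal_restrict_apply (σ.measurableSet_first_eq y _)]
    by_cases hz : G.adj y z
    · obtain ⟨i, hi⟩ := (σ.nbr y).surjective ⟨z, hz⟩
      have h3 : {x | σ.first y x = some z} ∩ Set.Icc 0 (G.rate y) = σ.firstPart y i := by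
        ext x
        simp only [Set.mem_inter_iff, Set.mem_ofPred_eq, first_eq_some_iff]
        constructor
        · rintro ⟨⟨j, hj, hx⟩, -⟩
          have : j = i := (σ.nbr y).injective (Subtype.ext (by rw [hj, hi]))
          exact this ▸ hx
        · refine fun hx => ⟨⟨i, by rw [hi], hx⟩, ?_, ?_⟩
          · exact (Finset.sum_nonneg fun j _ => σ.val_nonneg y j).trans hx.1
          · exact hx.2.le.trans ((σ.sum_val_mono y (Finset.filter_subset _ _)).trans
              (σ.sum_val_le_rate hb y))
      rw [h3, firstPart, sum_val_le_eq, Real.volume_real_Ico]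
      simp [val, hi, M.frac_nonneg]
    · have h3 : {x | σ.first y x = some z} = ∅ := by
        ext x
        simp only [Set.mem_ofPred_eq, first_eq_some_iff, Set.mem_empty_iff_false, iff_false]
        rintro ⟨i, rfl, _⟩
        exact hz (σ.nbr y i).2
      simp [h3, M.frac_eq_zero_of_not_adj hz]
  · intro o _ ho
    simp [ho]
  · simp

theorem sum_pairRate_second (hb : 0 < b) (y : Y) (z : Z) :
    ∑ o, σ.pairRate y (o, some z) = M.frac y z := by
  classical
  have h := σ.integral_pair hb y fun p => if p.2 = some z then 1 else 0
  rw [Fintype.sum_prod_type_right, Finset.sum_eq_single (some z)] at h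
  · simp only [if_true, mul_one] at h
    rw [← h]
    have h2 : (fun x => if σ.second y x = some z then (1 : ℝ) else 0)
        = Set.indicator {x | σ.second y x = some z} fun _ => 1 := by
      ext x; simp [Set.indicator_apply]
    rw [h2, integral_indicator_const _ (σ.measurableSet_second_eq hb y _), smul_eq_mul, mul_one,
      measureReal_restrict_apply (σ.measurableSet_second_eq hb y _)]
    by_cases hz : G.adj y z
    · obtain ⟨i, hi⟩ := (σ.nbr y).surjective ⟨z, hz⟩
      have hr := σ.sum_val_le_rate hb y
      have h3 : {x | σ.second y x = some z} ∩ Set.Icc 0 (G.rate y) = σ.secondPart y i := by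
        ext x
        simp only [Set.mem_inter_iff, Set.mem_ofPred_eq, σ.second_eq_some_iff hb]
        constructor
        · rintro ⟨⟨j, hj, hx⟩, -⟩
          have : j = i := (σ.nbr y).injective (Subtype.ext (by rw [hj, hi]))
          exact this ▸ hx
        · refine fun hx => ⟨⟨i, by rw [hi], hx⟩, ?_⟩
          rw [secondPart] at hx
          split_ifs at hx with h0
          · have := Finset.single_le_sum (fun j _ => σ.val_nonneg y j) (Finset.mem_univ i)
            exact ⟨(by linarith : (0 : ℝ) ≤ G.rate y - σ.val y i).trans hx.1, hx.2.le⟩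
          · exact ⟨(Finset.sum_nonneg fun j _ => σ.val_nonneg y j).trans hx.1,
              hx.2.le.trans ((σ.sum_val_mono y (Finset.filter_subset _ _)).trans hr)⟩
      rw [h3, secondPart]
      split_ifs with h0
      · rw [Real.volume_real_Ico]
        simp [val, hi, M.frac_nonneg]
      · rw [σ.sum_val_pos_le_eq y i h0, Real.volume_real_Ico]
        simp [val, hi, M.frac_nonneg]
    · have h3 : {x | σ.second y x = some z} = ∅ := by
        ext x
        simp only [Set.mem_ofPred_eq, σ.second_eq_some_iff hb, Set.mem_empty_iff_false, iff_false]
        rintro ⟨i, rfl, _⟩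
        exact hz (σ.nbr y i).2
      simp [h3, M.frac_eq_zero_of_not_adj hz]
  · intro o _ ho
    simp [ho]
  · simp

/-- A bin gets both priorities only if more than half of the rate of `y` goes to it. -/
theorem pairRate_diag_le (hb : 0 < b) (y : Y) (z : Z) :
    σ.pairRate y (some z, some z) ≤ max 0 (2 * M.frac y z - G.rate y) := by
  have h : {x ∈ Set.Icc 0 (G.rate y) | (σ.first y x, σ.second y x) = (some z, some z)}
      ⊆ Set.Ico (G.rate y - M.frac y z) (M.frac y z) := by
    rintro x ⟨-, hx⟩
    rw [Prod.ext_iff, first_eq_some_iff, σ.second_eq_some_iff hb] at hx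
    obtain ⟨⟨i, hi, hxi⟩, j, hj, hxj⟩ := hx
    obtain rfl : i = j := (σ.nbr y).injective (Subtype.ext (hi.trans hj.symm))
    rw [firstPart, sum_val_le_eq] at hxi
    rw [secondPart] at hxj
    have hv : σ.val y i = M.frac y z := by rw [val, hi]
    split_ifs at hxj with h0
    · refine ⟨hv ▸ hxj.1, ?_⟩
      have : ∑ j with j < i, σ.val y j = 0 := by
        rw [Finset.filter_false_of_mem, Finset.sum_empty]
        intro j _ hj
        have := Fin.lt_def.1 hj
        omega
      rw [this, zero_add, hv] at hxi
      exact hxi.2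
    -- The second interval of this edge is its first interval moved left by the largest value at
    -- `y`, hence by at least its own length, so the two cannot meet.
    · exfalso
      let k : Fin (σ.deg y) := ⟨0, by have := i.2; omega⟩
      have h1 := σ.sum_val_le_eq_zero_add y i k rfl
      rw [sum_val_le_eq] at h1
      have h2 : σ.val y i ≤ σ.val y k := σ.antitone y (Fin.le_def.2 (Nat.zero_le _))
      have := hxi.1
      have := hxj.2
      linarith
  refine (measureReal_mono h (by simp)).trans ?_
  rw [Real.volume_real_Ico, max_comm]
  exact max_le_max le_rfl (by linarith)

end EdgeOrder
end OfflineOpt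
end StochasticMatching
end

/-! ### The algorithm as a Markov chain -/

noncomputable section

namespace StochasticMatching

variable {Y Z : Type*} [Fintype Y] [Fintype Z] {b : ℕ} {G : StochasticMatching Y Z b}

open Classical in
/-- The set of full bins after a ball with first priority `p.1` and second priority `p.2` arrives
when the set of full bins is `S`. -/
def place (S : Finset Z) (p : Option Z × Option Z) : Finset Z :=
  if ∃ z, p.1 = some z ∧ z ∉ S then S ∪ p.1.toFinset else S ∪ p.2.toFinset

namespace OfflineOpt
namespace EdgeOrder

open MeasureTheory

variable {M : G.OfflineOpt} (σ : M.EdgeOrder)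

omit [Fintype Z] in
theorem step_eq_place (S : Finset Z) (y : Y) (x : ℝ) :
    σ.step S y x = place S (σ.first y x, σ.second y x) := rfl

variable (G) in
/-- Law of the random number of a ball of type `y`. -/
def drawLaw (y : Y) : Measure ℝ := ProbabilityTheory.cond volume (Set.Icc 0 (G.rate y))

instance (y : Y) : IsFiniteMeasure (drawLaw G y) := by
  unfold drawLaw; infer_instance

omit [Fintype Z] in
-- For rate zero the conditional law is the zero measure and both sides vanish; the factor `G.rate
-- y` makes a positivity hypothesis unnecessary.
theorem rate_mul_integral_drawLaw (y : Y) (f : ℝ → ℝ) :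
    G.rate y * ∫ x, f x ∂(drawLaw G y) = ∫ x in Set.Icc 0 (G.rate y), f x := by
  rw [drawLaw, ProbabilityTheory.cond, integral_smul_measure, smul_eq_mul, ENNReal.toReal_inv,
    Real.volume_Icc, sub_zero, ENNReal.toReal_ofReal (G.rate_nonneg y)]
  by_cases h : G.rate y = 0
  · simp [h]
  · field_simp

/-- The set of full bins after a sequence of `n` balls. -/
def run : (n : ℕ) → (Fin n → Y) → (Fin n → ℝ) → Finset Z
  | 0, _, _ => ∅
  | n + 1, ω, x =>
    σ.step (run n (Fin.init ω) (Fin.init x)) (ω (Fin.last n)) (x (Fin.last n))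

omit [Fintype Z] in
theorem full_eq_run (ω : Fin b → Y) (x : Fin b → ℝ) (t : ℕ) (ht : t ≤ b) :
    σ.full ω x t = σ.run t (fun i => ω (Fin.castLE ht i)) (fun i => x (Fin.castLE ht i)) := by
  induction t with
  | zero => rfl
  | succ t ih =>
    rw [full, dif_pos (Nat.lt_of_succ_le ht), ih (Nat.le_of_succ_le ht)]
    rfl

/-- State and priorities take finitely many values, so the function is a finite sum of products of
indicators of measurable events. -/
theorem measurable_run (hb : 0 < b) {n : ℕ} (ω : Fin n → Y) (φ : Finset Z → ℝ) :
    Measurable fun x => φ (σ.run n ω x) := by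
  classical
  induction n generalizing φ with
  | zero => simp only [run, measurable_const]
  | succ n ih =>
    have h : ∀ x : Fin (n + 1) → ℝ, φ (σ.run (n + 1) ω x) = ∑ S, ∑ p,
        (if σ.run n (Fin.init ω) (Fin.init x) = S then 1 else 0) *
        (Set.indicator {ξ | (σ.first (ω (Fin.last n)) ξ, σ.second (ω (Fin.last n)) ξ) = p}
          (fun _ => φ (place S p)) (x (Fin.last n))) := by
      intro x
      simp [run, step_eq_place, Set.indicator_apply]
    simp_rw [h]
    refine Finset.measurable_sum _ fun S _ => Finset.measurable_sum _ fun p _ => ?_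
    refine Measurable.mul ?_ ?_
    · have h1 : Measurable fun x : Fin (n + 1) → ℝ => (Fin.init x : Fin n → ℝ) :=
        measurable_pi_lambda _ fun i => measurable_pi_apply _
      exact (ih (Fin.init ω) fun T => if T = S then 1 else 0).comp h1
    · exact (measurable_const.indicator
        (σ.measurableSet_pair_eq hb (ω (Fin.last n)) p)).comp (measurable_pi_apply _)

theorem integrable_run (hb : 0 < b) {n : ℕ} (ω : Fin n → Y) (φ : Finset Z → ℝ)
    (μ : Measure (Fin n → ℝ)) [IsFiniteMeasure μ] : Integrable (fun x => φ (σ.run n ω x)) μ := by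
  refine Integrable.of_bound (σ.measurable_run hb ω φ).aestronglyMeasurable (∑ S, |φ S|)
    (Filter.Eventually.of_forall fun x => ?_)
  exact Finset.single_le_sum (f := fun S => |φ S|) (fun S _ => abs_nonneg _) (Finset.mem_univ _)

/-- Rate of arrival of balls with first priority `p.1` and second priority `p.2`. -/
def totalRate (p : Option Z × Option Z) : ℝ := ∑ y, σ.pairRate y p

/-- The transition operator of the Markov chain of the sets of full bins. -/
def transition (φ : Finset Z → ℝ) (S : Finset Z) : ℝ :=
  (∑ p, σ.totalRate p * φ (place S p)) / b

theorem transition_eq (hb : 0 < b) (φ : Finset Z → ℝ) (S : Finset Z) :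
    σ.transition φ S = ∑ y, G.rate y / b * ∫ ξ, φ (σ.step S y ξ) ∂(drawLaw G y) := by
  simp_rw [div_mul_eq_mul_div, rate_mul_integral_drawLaw, ← Finset.sum_div, step_eq_place,
    σ.integral_pair hb _ fun p => φ (place S p)]
  rw [transition, Finset.sum_comm]
  simp_rw [totalRate, Finset.sum_mul]

/-- Fubini, with the random number of the last ball as the inner variable. -/
theorem integral_run_succ (hb : 0 < b) {n : ℕ} (ω : Fin n → Y) (y : Y) (φ : Finset Z → ℝ) :
    ∫ x, φ (σ.run (n + 1) (Fin.snoc (α := fun _ => Y) ω y) x)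
        ∂(Measure.pi fun t => drawLaw G (Fin.snoc (α := fun _ => Y) ω y t))
      = ∫ x, (∫ ξ, φ (σ.step (σ.run n ω x) y ξ) ∂(drawLaw G y))
        ∂(Measure.pi fun t => drawLaw G (ω t)) := by
  have hm := (measurePreserving_piFinSuccAbove
    (fun t => drawLaw G (Fin.snoc (α := fun _ => Y) ω y t)) (Fin.last n)).symm
  rw [← hm.integral_comp']
  have hi : Integrable (fun q => φ (σ.run (n + 1) (Fin.snoc (α := fun _ => Y) ω y)
      ((MeasurableEquiv.piFinSuccAbove (fun _ => ℝ) (Fin.last n)).symm q)))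
      ((drawLaw G (Fin.snoc (α := fun _ => Y) ω y (Fin.last n))).prod (Measure.pi fun j =>
        drawLaw G (Fin.snoc (α := fun _ => Y) ω y ((Fin.last n).succAbove j)))) :=
    hm.integrable_comp_of_integrable (σ.integrable_run hb _ φ _)
  rw [integral_prod_symm _ hi]
  simp [MeasurableEquiv.piFinSuccAbove, Fin.insertNthEquiv, run, Fin.insertNth_last', Fin.succAbove_last]

/-- The state of the algorithm is a Markov chain. -/
theorem sum_integral_run (hb : 0 < b) (n : ℕ) (φ : Finset Z → ℝ) :
    ∑ ω : Fin n → Y, (∏ t, G.rate (ω t) / b) *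
      ∫ x, φ (σ.run n ω x) ∂(Measure.pi fun t => drawLaw G (ω t)) = σ.transition^[n] φ ∅ := by
  induction n generalizing φ with
  | zero => simp [run, measureReal_def]
  | succ n ih =>
    -- Averaging over the last ball replaces φ by `transition φ`, which is why the induction is over
    -- all φ.
    rw [Function.iterate_succ_apply, ← ih, ← (Fin.snocEquiv fun _ => Y).sum_comp,
      Fintype.sum_prod_type_right]
    refine Finset.sum_congr rfl fun ω _ => ?_
    simp only [Fin.snocEquiv, Equiv.coe_fn_mk, σ.integral_run_succ hb, Fin.prod_univ_castSucc,
      Fin.snoc_castSucc, Fin.snoc_last, σ.transition_eq hb]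
    rw [integral_finsetSum]
    · rw [Finset.mul_sum]
      refine Finset.sum_congr rfl fun y _ => ?_
      rw [integral_const_mul, mul_assoc]
    · intro y _
      exact (σ.integrable_run hb ω (fun S => ∫ ξ, φ (σ.step S y ξ) ∂(drawLaw G y)) _).const_mul _

theorem expectedAlg_eq (hb : 0 < b) :
    σ.expectedAlg = σ.transition^[b] (fun S => (S.card : ℝ)) ∅ := by
  rw [← σ.sum_integral_run hb]
  simp_rw [expectedAlg, prob, G.sum_rate, σ.full_eq_run _ _ b le_rfl]
  rfl

end EdgeOrder
end OfflineOpt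
end StochasticMatching
end

/-! ### Numerical inequalities -/

noncomputable section

namespace StochasticMatching

/-- Lowering the Taylor coefficient 1/6 to 0.13 absorbs the tail on all of [0, 1]. -/
theorem exp_neg_le_cubic {a : ℝ} (h0 : 0 ≤ a) (h1 : a ≤ 1) :
    Real.exp (-a) ≤ 1 - a + a ^ 2 / 2 - 0.13 * a ^ 3 := by
  have h := Real.exp_bound (x := -a) (by rw [abs_neg, abs_of_nonneg h0]; exact h1) (n := 6)
    (by norm_num)
  rw [abs_neg, abs_of_nonneg h0] at h
  have h2 := (abs_le.1 h).2
  norm_num [Finset.sum_range_succ, Nat.factorial] at h2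
  have h5 : a ^ 6 ≤ a ^ 5 := pow_le_pow_of_le_one h0 h1 (by norm_num)
  have h4 : a ^ 4 ≤ a ^ 3 := pow_le_pow_of_le_one h0 h1 (by norm_num)
  have h3 : 0 ≤ a ^ 3 := by positivity
  nlinarith

theorem exp_neg_one_bounds : 0.3678 ≤ Real.exp (-1) ∧ Real.exp (-1) ≤ 0.36788 := by
  have h1 := Real.exp_one_gt_d9
  have h2 := Real.exp_one_lt_d9
  rw [Real.exp_neg]
  exact ⟨(le_inv_comm₀ (by norm_num) (Real.exp_pos 1)).2 (by norm_num at *; linarith),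
    (inv_le_comm₀ (Real.exp_pos 1) (by norm_num)).2 (by norm_num at *; linarith)⟩

/-- Expansion about a = 1, with 0.36788 just above 1/e; the coefficient 0.6 in place of 1/2 absorbs
the higher terms for 1 - a ≤ 1/2. -/
theorem exp_neg_le_quadratic {a : ℝ} (h0 : 1 / 2 ≤ a) (h1 : a ≤ 1) :
    Real.exp (-a) ≤ 0.36788 * (1 + (1 - a) + 0.6 * (1 - a) ^ 2) := by
  have hd : 0 ≤ 1 - a := by linarith
  have h := Real.exp_bound' hd (by linarith) (n := 4) (by norm_num)
  norm_num [Finset.sum_range_succ, Nat.factorial] at h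
  have h2 : Real.exp (1 - a) ≤ 1 + (1 - a) + 0.6 * (1 - a) ^ 2 := by
    have h3 : (1 - a) ^ 3 ≤ 1 / 2 * (1 - a) ^ 2 := by
      nlinarith [mul_nonneg (sq_nonneg (1 - a)) (by linarith : 0 ≤ a - 1 / 2)]
    have h4 : (1 - a) ^ 4 ≤ 1 / 4 * (1 - a) ^ 2 := by
      nlinarith [mul_nonneg (sq_nonneg (1 - a)) (by linarith : 0 ≤ a - 1 / 2)]
    have : 0 ≤ (1 - a) ^ 2 := sq_nonneg _
    linarith
  rw [show -a = -1 + (1 - a) by ring, Real.exp_add]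
  exact mul_le_mul exp_neg_one_bounds.2 h2 (Real.exp_pos _).le (by norm_num)

/-- The range is that of the diagonal rate: 0.2645 = 2(1 - 0.36775) - 1. -/
theorem exp_le_chord {s : ℝ} (h0 : 0 ≤ s) (h1 : s ≤ 0.2645) :
    Real.exp s ≤ 1 + 1.148 * s := by
  have h := Real.exp_bound' h0 (by norm_num at *; linarith) (n := 3) (by norm_num)
  norm_num [Finset.sum_range_succ, Nat.factorial] at h
  have h3 : s ^ 3 ≤ 0.2645 ^ 2 * s := by
    rw [pow_succ]
    exact mul_le_mul_of_nonneg_right (pow_le_pow_left₀ h0 h1 2) h0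
  have h2 : s ^ 2 ≤ 0.2645 * s := by
    rw [sq]
    exact mul_le_mul_of_nonneg_right h1 h0
  norm_num at *
  linarith

/-- The bound on a single bin of load `a ≤ 1` with `s = 0`. -/
theorem bin_bound_zero {a : ℝ} (h0 : 0 ≤ a) (h1 : a ≤ 1) :
    0.705 * a ≤ 1 - Real.exp (-a) ^ 2
      - a * ((Real.exp (-a) ^ 2 + Real.exp (-a)) / 2 - 0.116 * a + 0.0005) := by
  set x := Real.exp (-a) with hx
  have hx0 : 0 ≤ x := (Real.exp_pos _).le
  have hp := exp_neg_le_cubic h0 h1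
  rw [← hx] at hp
  set p := 1 - a + a ^ 2 / 2 - 0.13 * a ^ 3 with hpd
  have hx2 : x ^ 2 ≤ p ^ 2 := pow_le_pow_left₀ hx0 hp 2
  have hQ : 0.705 * a ≤ 1 - p ^ 2 - a * ((p ^ 2 + p) / 2 - 0.116 * a + 0.0005) := by
    have hd : 0 ≤ 1 - a := by linarith
    -- The difference of the two sides, divided by a, has nonnegative coefficients in the Bernstein
    -- basis of degree 6.
    have : 0 ≤ a * ((589/2000) * (1-a)^6 + (1383/1000) * (a * (1-a)^5)
        + (1003/400) * (a^2 * (1-a)^4) + (91/40) * (a^3 * (1-a)^3)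
        + (427/400) * (a^4 * (1-a)^2) + (2401/10000) * (a^5 * (1-a)) + (403/20000) * a^6) := by
      positivity
    rw [hpd]
    linarith
  have := mul_le_mul_of_nonneg_left hx2 h0
  have := mul_le_mul_of_nonneg_left hp h0
  linarith

/-- The bound on a single bin of load `a ≥ 1 / 2`. -/
theorem bin_bound_of_half_le {a s : ℝ} (h0 : 1 / 2 ≤ a) (h1 : a ≤ 1) (hs : 0 ≤ s)
    (hs1 : s ≤ 0.2645) :
    0.705 * a ≤ 1 - Real.exp (-a) ^ 2 * Real.exp s
      - (a - s) * ((Real.exp (-a) ^ 2 * Real.exp s + Real.exp (-a)) / 2 - 0.116 * a + 0.0005) := by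
  set x := Real.exp (-a) with hx
  have hx0 : 0 ≤ x := (Real.exp_pos _).le
  have hq := exp_neg_le_quadratic h0 h1
  rw [← hx] at hq
  set q := 0.36788 * (1 + (1 - a) + 0.6 * (1 - a) ^ 2) with hqd
  have hx2 : x ^ 2 ≤ q ^ 2 := pow_le_pow_left₀ hx0 hq 2
  -- Tangent to s² at 0.2645. It replaces the term -0.574 s² below and leaves a bound affine in s.
  have hss : 0.529 * s - 0.2645 ^ 2 ≤ s ^ 2 := by
    have := sq_nonneg (s - 0.2645)
    norm_num at *
    linarith
  have has : 0 ≤ a - s := by norm_num at *; linarith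
  have hE : Real.exp s * (1 + (a - s) / 2)
      ≤ 1 + a / 2 + s * (1.148 * (1 + a / 2) - 1 / 2) - 0.574 * (0.529 * s - 0.2645 ^ 2) := by
    have := mul_le_mul_of_nonneg_right (exp_le_chord hs hs1)
      (by linarith : 0 ≤ 1 + (a - s) / 2)
    linarith
  set L := fun u : ℝ => 1 + a / 2 + u * (1.148 * (1 + a / 2) - 1 / 2)
    - 0.574 * (0.529 * u - 0.2645 ^ 2) with hL
  have hxE : x ^ 2 * (Real.exp s * (1 + (a - s) / 2)) ≤ q ^ 2 * L s :=
    mul_le_mul hx2 hE (mul_nonneg (Real.exp_pos _).le (by linarith)) (sq_nonneg q)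
  have hxq := mul_le_mul_of_nonneg_left hq has
  have hd : 0 ≤ (1 - a) * (1 / 2 - (1 - a)) := mul_nonneg (by linarith) (by linarith)
  have hd0 : 0 ≤ 1 - a := by linarith
  have hd3 : 0 ≤ (1 - a) ^ 3 := by positivity
  have hd4 : 0 ≤ (1 - a) ^ 4 := by positivity
  have hd5 : 0 ≤ (1 - a) ^ 5 := by positivity
  -- Being affine in s, the bound need only be checked at s = 0 and s = 0.2645, where it is a
  -- polynomial in 1 - a ∈ [0, 1/2].
  have hP0 : 0 ≤ 1 - q ^ 2 * L 0 - a * (q / 2 - 0.116 * a + 0.0005) - 0.705 * a := by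
    simp only [hL, hqd]
    linarith
  have hP1 : 0 ≤ 1 - q ^ 2 * L 0.2645 - (a - 0.2645) * (q / 2 - 0.116 * a + 0.0005)
      - 0.705 * a := by
    simp only [hL, hqd]
    linarith
  have hP : 0 ≤ 1 - q ^ 2 * L s - (a - s) * (q / 2 - 0.116 * a + 0.0005) - 0.705 * a := by
    have h2 := mul_nonneg (by linarith : 0 ≤ 0.2645 - s) hP0
    have h3 := mul_nonneg hs hP1
    simp only [hL] at h2 h3 ⊢
    linarith
  linarith

/-- The discrete convolution of two geometric decays, up to an error of order `1 / b`. -/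
theorem geom_sum_le {b : ℕ} (hb : 4 ≤ b) {c m : ℝ} (hc0 : 0 ≤ c) (hc : c ≤ 2) (hm0 : 0 ≤ m)
    (hm : m ≤ 2) :
    (∑ t ∈ Finset.range b, (1 - m / b) ^ t * (1 - c / b) ^ (b - 1 - t)) / b
      ≤ (Real.exp (-c) + Real.exp (-m)) / 2 + 10 / b := by
  have hb0 : (4 : ℝ) ≤ b := by exact_mod_cast hb
  have hbp : (0 : ℝ) < b := by linarith
  have hexp : ∀ k : ℝ, k ≤ 2 → ∀ n : ℕ, (1 - k / b) ^ n ≤ Real.exp (-(k * n / b)) := by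
    intro k hk n
    have h1 : 0 ≤ 1 - k / b := by
      rw [sub_nonneg, div_le_one hbp]; linarith
    calc (1 - k / b) ^ n ≤ Real.exp (-(k / b)) ^ n :=
          pow_le_pow_left₀ h1 (Real.one_sub_le_exp_neg _) n
      _ = Real.exp (-(k * n / b)) := by
          rw [← Real.exp_nat_mul]; congr 1; ring
  have hE : Real.exp (2 / b) ≤ 1 + 4 / b := by
    have h1 := Real.one_sub_le_exp_neg (2 / (b : ℝ))
    rw [Real.exp_neg] at h1
    have h2 : (2 : ℝ) / b ≤ 1 / 2 := by rw [div_le_iff₀ hbp]; linarith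
    have h3 : Real.exp (2 / b) ≤ (1 - 2 / (b : ℝ))⁻¹ :=
      (le_inv_comm₀ (Real.exp_pos _) (by linarith)).2 h1
    refine h3.trans ?_
    rw [inv_le_iff_one_le_mul₀ (by linarith)]
    have h4 : (4 : ℝ) / b = 2 * (2 / b) := by ring
    have h5 : (0 : ℝ) ≤ 2 / b := by positivity
    rw [h4]
    nlinarith
  have hterm : ∀ t ∈ Finset.range b, (1 - m / b) ^ t * (1 - c / b) ^ (b - 1 - t)
      ≤ Real.exp (2 / b) * ((1 - t / b) * Real.exp (-c) + t / b * Real.exp (-m)) := by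
    intro t ht
    have htb : t + 1 ≤ b := Finset.mem_range.1 ht
    have htb' : (t : ℝ) + 1 ≤ b := by exact_mod_cast htb
    have hcast : ((b - 1 - t : ℕ) : ℝ) = b - 1 - t := by
      rw [Nat.sub_sub, Nat.cast_sub (by omega)]; push_cast; ring
    have h1 := mul_le_mul (hexp m hm t) (hexp c hc (b - 1 - t))
      (pow_nonneg (by rw [sub_nonneg, div_le_one hbp]; linarith) _) (Real.exp_pos _).le
    refine h1.trans ?_
    -- The surplus c/b arises because the exponents t and b - 1 - t add up to b - 1 only; it costs
    -- the factor exp(2/b).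
    rw [← Real.exp_add, hcast, show -(m * t / b) + -(c * ((b : ℝ) - 1 - t) / b)
      = c / b + ((1 - t / b) * (-c) + t / b * (-m)) by field_simp; ring, Real.exp_add]
    have ht1 : (t : ℝ) / b ≤ 1 := by rw [div_le_one hbp]; linarith
    -- The chord of exp between -c and -m; averaged over t it gives the midpoint value up to O(1/b).
    have h2 := convexOn_exp.2 (Set.mem_univ (-c)) (Set.mem_univ (-m))
      (by linarith : 0 ≤ 1 - (t : ℝ) / b) (by positivity : 0 ≤ (t : ℝ) / b) (by ring)
    simp only [smul_eq_mul] at h2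
    refine mul_le_mul (Real.exp_le_exp.2 ?_) h2 (Real.exp_pos _).le (Real.exp_pos _).le
    gcongr
  have hsum : ∑ t ∈ Finset.range b, (t : ℝ) = b * (b - 1) / 2 := by
    have := Finset.sum_range_id_mul_two b
    have h2 : ((∑ t ∈ Finset.range b, t : ℕ) : ℝ) * 2 = b * ((b - 1 : ℕ) : ℝ) := by
      exact_mod_cast this
    rw [Nat.cast_sub (by omega)] at h2
    push_cast at h2
    linarith
  have htot : ∑ t ∈ Finset.range b,
      Real.exp (2 / b) * ((1 - t / b) * Real.exp (-c) + t / b * Real.exp (-m))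
      = b * (Real.exp (2 / b) * ((Real.exp (-c) + Real.exp (-m)) / 2
        + (Real.exp (-c) - Real.exp (-m)) * (1 / b / 2))) := by
    rw [← Finset.mul_sum, Finset.sum_add_distrib, ← Finset.sum_mul, ← Finset.sum_mul,
      Finset.sum_sub_distrib, ← Finset.sum_div, hsum]
    simp
    field_simp
    ring
  rw [div_le_iff₀ hbp]
  refine (Finset.sum_le_sum hterm).trans ?_
  rw [htot, mul_comm]
  refine mul_le_mul_of_nonneg_right ?_ hbp.le
  have hc1 : Real.exp (-c) ≤ 1 := Real.exp_le_one_iff.2 (by linarith)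
  have hm1 : Real.exp (-m) ≤ 1 := Real.exp_le_one_iff.2 (by linarith)
  have hcp := Real.exp_pos (-c)
  have hmp := Real.exp_pos (-m)
  have hi : (0 : ℝ) < 1 / b := by positivity
  have hi1 : (1 : ℝ) / b ≤ 1 := by rw [div_le_one hbp]; linarith
  set X := Real.exp (-c)
  set W := Real.exp (-m)
  have hB : (X + W) / 2 + (X - W) * (1 / b / 2) ≤ (X + W) / 2 + 1 / b / 2 := by
    have := mul_le_mul_of_nonneg_right (by linarith : X - W ≤ 1) (by positivity : (0 : ℝ) ≤ 1 / b / 2)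
    linarith
  have hB0 : (0 : ℝ) ≤ (X + W) / 2 + 1 / b / 2 := by positivity
  calc Real.exp (2 / b) * ((X + W) / 2 + (X - W) * (1 / b / 2))
      ≤ (1 + 4 / b) * ((X + W) / 2 + 1 / b / 2) :=
        (mul_le_mul_of_nonneg_left hB (Real.exp_pos _).le).trans
          (mul_le_mul_of_nonneg_right hE hB0)
    _ = ((X + W) / 2 + 1 / b / 2) + 4 * (1 / b) * ((X + W) / 2 + 1 / b / 2) := by ring
    _ ≤ ((X + W) / 2 + 1 / b / 2) + 4 * (1 / b) * 2 := by
        gcongr; linarith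
    _ ≤ (X + W) / 2 + 10 / b := by
        rw [show (10 : ℝ) / b = 10 * (1 / b) by ring]; linarith

end StochasticMatching
end

/-! ### Decay of the emptiness probabilities -/

noncomputable section

namespace StochasticMatching

variable {Y Z : Type*} [Fintype Y] [Fintype Z] {b : ℕ} {G : StochasticMatching Y Z b}

open Classical in
/-- The indicator of the event that the bin `z` is empty. -/
def empty (z : Z) (S : Finset Z) : ℝ := if z ∈ S then 0 else 1

/-- The indicator of the event that the bins `z` and `z'` are both empty. -/
def emptyPair (z z' : Z) (S : Finset Z) : ℝ := empty z S * empty z' S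

omit [Fintype Z] in
theorem empty_nonneg (z : Z) (S : Finset Z) : 0 ≤ empty z S := by
  unfold empty; split_ifs <;> norm_num

omit [Fintype Z] in
theorem empty_le_one (z : Z) (S : Finset Z) : empty z S ≤ 1 := by
  unfold empty; split_ifs <;> norm_num

omit [Fintype Z] in
theorem subset_place (S : Finset Z) (p : Option Z × Option Z) : S ⊆ place S p := by
  classical
  unfold place; split_ifs <;> exact Finset.subset_union_left

omit [Fintype Z] in
theorem empty_place_of_mem {z : Z} {S : Finset Z} (h : z ∈ S) (p : Option Z × Option Z) :
    empty z (place S p) = 0 := if_pos (subset_place S p h)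

omit [Fintype Z] in
theorem mem_place_of_first {z : Z} {S : Finset Z} {p : Option Z × Option Z} (h : p.1 = some z) :
    z ∈ place S p := by
  classical
  by_cases hz : z ∈ S
  · exact subset_place S p hz
  · rw [place, if_pos ⟨z, h, hz⟩]
    simp [h]

omit [Fintype Z] in
theorem mem_place_of_second {z : Z} {S : Finset Z} {p : Option Z × Option Z} (h : p.2 = some z)
    (h1 : ∀ z', p.1 = some z' → z' ∈ S) : z ∈ place S p := by
  classical
  rw [place, if_neg (by rintro ⟨z', hz', hz''⟩; exact hz'' (h1 z' hz'))]
  simp [h]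

namespace OfflineOpt
namespace EdgeOrder

variable {M : G.OfflineOpt} (σ : M.EdgeOrder)

omit [Fintype Z] in
theorem totalRate_nonneg (p : Option Z × Option Z) : 0 ≤ σ.totalRate p :=
  Finset.sum_nonneg fun y _ => σ.pairRate_nonneg y p

variable (M) in
/-- The expected number of balls that the offline optimum puts into the bin `z`. -/
def load (z : Z) : ℝ := ∑ y, M.frac y z

/-- Rate of arrival of balls with both priorities equal to `z`. -/
def diagRate (z : Z) : ℝ := σ.totalRate (some z, some z)

theorem sum_totalRate (hb : 0 < b) : ∑ p, σ.totalRate p = b := by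
  simp_rw [totalRate]
  rw [Finset.sum_comm]
  simp_rw [σ.sum_pairRate hb, G.sum_rate]

theorem sum_totalRate_first (hb : 0 < b) (z : Z) : ∑ o, σ.totalRate (some z, o) = load M z := by
  simp_rw [totalRate]
  rw [Finset.sum_comm]
  simp_rw [σ.sum_pairRate_first hb, load]

theorem sum_totalRate_second (hb : 0 < b) (z : Z) : ∑ o, σ.totalRate (o, some z) = load M z := by
  simp_rw [totalRate]
  rw [Finset.sum_comm]
  simp_rw [σ.sum_pairRate_second hb, load]

omit [Fintype Z] in
theorem load_nonneg (z : Z) : 0 ≤ load M z := Finset.sum_nonneg fun y _ => M.frac_nonneg y z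

omit [Fintype Z] in
theorem load_le_one (hb : 0 < b) (z : Z) : load M z ≤ 1 := M.sum_frac_le_one hb z

omit [Fintype Z] in
theorem diagRate_nonneg (z : Z) : 0 ≤ σ.diagRate z := σ.totalRate_nonneg _

theorem diagRate_le_load (hb : 0 < b) (z : Z) : σ.diagRate z ≤ load M z := by
  rw [← σ.sum_totalRate_first hb]
  exact Finset.single_le_sum (f := fun o => σ.totalRate (some z, o))
    (fun o _ => σ.totalRate_nonneg _) (Finset.mem_univ (some z))

open Classical in
theorem sum_mul_ite_first (hb : 0 < b) (z : Z) :
    ∑ p, σ.totalRate p * (if p.1 = some z then 1 else 0) = load M z := by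
  rw [Fintype.sum_prod_type, Finset.sum_eq_single (some z), ← σ.sum_totalRate_first hb]
  · simp
  · intro o _ ho; simp [ho]
  · simp

open Classical in
theorem sum_mul_ite_second (hb : 0 < b) (z : Z) :
    ∑ p, σ.totalRate p * (if p.2 = some z then 1 else 0) = load M z := by
  rw [Fintype.sum_prod_type_right, Finset.sum_eq_single (some z), ← σ.sum_totalRate_second hb]
  · simp
  · intro o _ ho; simp [ho]
  · simp

open Classical in
-- Only an inequality, since balls whose first priority is the dummy bin are left out.
theorem sum_totalRate_erase_second (hb : 0 < b) (z : Z) :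
    ∑ z' ∈ Finset.univ.erase z, σ.totalRate (some z', some z) ≤ load M z - σ.diagRate z := by
  have h := σ.sum_totalRate_second hb z
  rw [Fintype.sum_option, ← Finset.sum_erase_add _ _ (Finset.mem_univ z)] at h
  have := σ.totalRate_nonneg (none, some z)
  rw [diagRate]
  linarith

open Classical in
theorem sum_totalRate_erase_first (hb : 0 < b) (z : Z) :
    ∑ z' ∈ Finset.univ.erase z, σ.totalRate (some z, some z') ≤ load M z - σ.diagRate z := by
  have h := σ.sum_totalRate_first hb z
  rw [Fintype.sum_option, ← Finset.sum_erase_add _ _ (Finset.mem_univ z)] at h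
  have := σ.totalRate_nonneg (some z, none)
  rw [diagRate]
  linarith

theorem transition_mono {φ ψ : Finset Z → ℝ} (h : φ ≤ ψ) : σ.transition φ ≤ σ.transition ψ :=
  fun _ => div_le_div_of_nonneg_right (Finset.sum_le_sum fun p _ =>
    mul_le_mul_of_nonneg_left (h _) (σ.totalRate_nonneg p)) (Nat.cast_nonneg b)

/-- Expectation of a function of the state after `n` balls. -/
def stateExp : ℕ → (Finset Z → ℝ) →ₗ[ℝ] ℝ
  | 0 => LinearMap.proj ∅
  | n + 1 => stateExp n ∘ₗ
    { toFun := σ.transition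
      map_add' := fun φ ψ => by
        ext S; simp [transition, mul_add, Finset.sum_add_distrib, add_div]
      map_smul' := fun c φ => by
        ext S
        simp only [transition, Pi.smul_apply, smul_eq_mul, RingHom.id_apply, mul_left_comm _ c,
          ← Finset.mul_sum, mul_div_assoc] }

theorem stateExp_succ (n : ℕ) (φ : Finset Z → ℝ) :
    σ.stateExp (n + 1) φ = σ.stateExp n (σ.transition φ) := rfl

theorem stateExp_eq_iterate (n : ℕ) (φ : Finset Z → ℝ) :
    σ.stateExp n φ = σ.transition^[n] φ ∅ := by
  induction n generalizing φ with
  | zero => rfl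
  | succ n ih => rw [stateExp_succ, ih, Function.iterate_succ_apply]

theorem stateExp_mono (n : ℕ) {φ ψ : Finset Z → ℝ} (h : φ ≤ ψ) :
    σ.stateExp n φ ≤ σ.stateExp n ψ := by
  induction n generalizing φ ψ with
  | zero => exact h ∅
  | succ n ih => exact ih (σ.transition_mono h)

theorem stateExp_one (hb : 0 < b) (n : ℕ) : σ.stateExp n 1 = 1 := by
  induction n with
  | zero => rfl
  | succ n ih =>
    rw [stateExp_succ, show σ.transition 1 = 1 from ?_, ih]
    ext S
    have : (b : ℝ) ≠ 0 := by positivity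
    simp [transition, σ.sum_totalRate hb, this]

/-- A ball with first priority z or z' surely ends the joint emptiness, and these events are
disjoint as z ≠ z'. Second priorities are neglected. -/
theorem transition_emptyPair_le (hb : 0 < b) {z z' : Z} (hz : z ≠ z') :
    σ.transition (emptyPair z z') ≤ (1 - (load M z + load M z') / b) • emptyPair z z' := by
  classical
  intro S
  have hbp : (0 : ℝ) < b := by exact_mod_cast hb
  rw [transition, Pi.smul_apply, smul_eq_mul, div_le_iff₀ hbp]
  by_cases hS : z ∈ S ∨ z' ∈ S
  · have h1 : ∀ p, emptyPair z z' (place S p) = 0 := fun p => by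
      rcases hS with hS | hS <;> simp [emptyPair, empty_place_of_mem hS]
    have h2 : emptyPair z z' S = 0 := by
      rcases hS with hS | hS <;> simp [emptyPair, empty, hS]
    simp [h1, h2]
  · push Not at hS
    have h2 : emptyPair z z' S = 1 := by simp [emptyPair, empty, hS]
    have h1 : ∀ p : Option Z × Option Z, emptyPair z z' (place S p)
        ≤ 1 - (if p.1 = some z then 1 else 0) - (if p.1 = some z' then 1 else 0) := by
      intro p
      by_cases h1 : p.1 = some z
      · have h3 : p.1 ≠ some z' := by rw [h1]; simpa using hz
        simp [emptyPair, empty, mem_place_of_first h1, h1, hz]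
      · by_cases h3 : p.1 = some z'
        · simp [emptyPair, empty, mem_place_of_first h3, h3, hz.symm]
        · simp only [h1, h3, if_false, sub_zero]
          exact mul_le_one₀ (empty_le_one _ _) (empty_nonneg _ _) (empty_le_one _ _)
    have h4 := Finset.sum_le_sum fun p (_ : p ∈ Finset.univ) =>
      mul_le_mul_of_nonneg_left (h1 p) (σ.totalRate_nonneg p)
    simp only [mul_sub, mul_one, Finset.sum_sub_distrib, σ.sum_mul_ite_first hb,
      σ.sum_totalRate hb] at h4
    rw [h2, mul_one, sub_mul, div_mul_cancel₀ _ hbp.ne']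
    linarith

open Classical in
-- Inclusion–exclusion on the priorities equal to z gives the rate 2a - s. The `emptyPair` terms
-- repay the balls that stop at an empty first priority z' and never try z.
theorem transition_empty_le (hb : 0 < b) (z : Z) :
    σ.transition (empty z) ≤ (1 - (2 * load M z - σ.diagRate z) / b) • empty z
      + ∑ z' ∈ Finset.univ.erase z, (σ.totalRate (some z', some z) / b) • emptyPair z z' := by
  intro S
  have hbp : (0 : ℝ) < b := by exact_mod_cast hb
  rw [transition, Pi.add_apply, Finset.sum_apply, div_le_iff₀ hbp]
  simp only [Pi.smul_apply, smul_eq_mul]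
  by_cases hS : z ∈ S
  · have h0 : empty z S = 0 := if_pos hS
    simp [empty_place_of_mem hS, emptyPair, h0]
  · have h2 : empty z S = 1 := by simp [empty, hS]
    have h1 : ∀ p : Option Z × Option Z, empty z (place S p)
        ≤ 1 - (if p.1 = some z then 1 else 0) - (if p.2 = some z then 1 else 0)
          + (if p = (some z, some z) then 1 else 0)
          + ∑ z' ∈ Finset.univ.erase z, if p = (some z', some z) then empty z' S else 0 := by
      rintro ⟨o, o'⟩
      have hnn : 0 ≤ ∑ z' ∈ Finset.univ.erase z,
          if (o, o') = (some z', some z) then empty z' S else 0 :=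
        Finset.sum_nonneg fun z' _ => by
          split_ifs
          exacts [empty_nonneg _ _, le_rfl]
      by_cases h1 : o = some z
      · have h3 : empty z (place S (o, o')) = 0 := if_pos (mem_place_of_first h1)
        rw [h3]
        by_cases h4 : o' = some z <;> simp [h1, h4] at hnn ⊢
      · by_cases h4 : o' = some z
        · by_cases h5 : ∀ z', o = some z' → z' ∈ S
          · have h3 : empty z (place S (o, o')) = 0 := if_pos (mem_place_of_second h4 h5)
            rw [h3]
            simp only [h1, h4, if_false, if_true, Prod.mk.injEq, false_and] at hnn ⊢
            linarith
          · push Not at h5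
            obtain ⟨z', rfl, hz'⟩ := h5
            have hzz : z' ∈ Finset.univ.erase z :=
              Finset.mem_erase.2 ⟨fun h => h1 (h ▸ rfl), Finset.mem_univ _⟩
            have h6 : (1 : ℝ) ≤ ∑ z'' ∈ Finset.univ.erase z,
                if (some z', o') = (some z'', some z) then empty z'' S else 0 := by
              refine le_trans ?_ (Finset.single_le_sum (fun z'' _ => ?_) hzz)
              · simp [h4, empty, hz']
              · split_ifs
                exacts [empty_nonneg _ _, le_rfl]
            have := empty_le_one z (place S (some z', o'))
            rw [if_neg h1, if_pos h4, if_neg (by rw [Prod.mk.injEq]; exact fun h => h1 h.1)]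
            linarith
        · have := empty_le_one z (place S (o, o'))
          rw [if_neg h1, if_neg h4, if_neg (by rw [Prod.mk.injEq]; exact fun h => h1 h.1)]
          linarith
    have h4 := Finset.sum_le_sum fun p (_ : p ∈ Finset.univ) =>
      mul_le_mul_of_nonneg_left (h1 p) (σ.totalRate_nonneg p)
    have h5 : ∑ p, σ.totalRate p * (∑ z' ∈ Finset.univ.erase z,
        if p = (some z', some z) then empty z' S else 0)
        = ∑ z' ∈ Finset.univ.erase z, σ.totalRate (some z', some z) * empty z' S := by
      simp_rw [Finset.mul_sum]
      rw [Finset.sum_comm]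
      simp
    have h6 : ∑ p, σ.totalRate p * (if p = (some z, some z) then 1 else 0) = σ.diagRate z := by
      simp [diagRate]
    simp only [mul_sub, mul_add, mul_one, Finset.sum_sub_distrib, Finset.sum_add_distrib,
      σ.sum_mul_ite_first hb, σ.sum_mul_ite_second hb, σ.sum_totalRate hb, h5, h6] at h4
    simp only [emptyPair, h2, one_mul, mul_one]
    rw [add_mul, sub_mul, div_mul_cancel₀ _ hbp.ne', Finset.sum_mul]
    have h7 : ∀ z', σ.totalRate (some z', some z) / b * empty z' S * b
        = σ.totalRate (some z', some z) * empty z' S := fun z' => by field_simp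
    simp_rw [h7]
    linarith

theorem stateExp_emptyPair_le (hb : 2 ≤ b) {z z' : Z} (hz : z ≠ z') (n : ℕ) :
    σ.stateExp n (emptyPair z z') ≤ (1 - (load M z + load M z') / b) ^ n := by
  have hb0 : 0 < b := by omega
  have hb2 : (2 : ℝ) ≤ b := by exact_mod_cast hb
  induction n with
  | zero => simp [stateExp, emptyPair, empty]
  | succ n ih =>
    rw [stateExp_succ]
    refine (σ.stateExp_mono n (σ.transition_emptyPair_le hb0 hz)).trans ?_
    rw [map_smul, smul_eq_mul, pow_succ']
    refine mul_le_mul_of_nonneg_left ih ?_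
    rw [sub_nonneg, div_le_one (by linarith)]
    have := load_le_one (M := M) hb0 z
    have := load_le_one (M := M) hb0 z'
    linarith

open Classical in
-- Discrete variation of constants: the contribution of `emptyPair` at time t decays at the rate of
-- z during the remaining n - 1 - t steps.
theorem stateExp_empty_le (hb : 2 ≤ b) (z : Z) (n : ℕ) :
    σ.stateExp n (empty z) ≤ (1 - (2 * load M z - σ.diagRate z) / b) ^ n
      + ∑ z' ∈ Finset.univ.erase z, (σ.totalRate (some z', some z) / b) *
        ∑ t ∈ Finset.range n, (1 - (load M z + load M z') / b) ^ t *
          (1 - (2 * load M z - σ.diagRate z) / b) ^ (n - 1 - t) := by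
  have hb0 : 0 < b := by omega
  have hb2 : (2 : ℝ) ≤ b := by exact_mod_cast hb
  induction n with
  | zero => simp [stateExp, empty]
  | succ n ih =>
    rw [stateExp_succ]
    refine (σ.stateExp_mono n (σ.transition_empty_le hb0 z)).trans ?_
    rw [map_add, map_smul, map_sum, smul_eq_mul]
    have h1 : 0 ≤ 1 - (2 * load M z - σ.diagRate z) / b := by
      rw [sub_nonneg, div_le_one (by linarith)]
      have := load_le_one (M := M) hb0 z
      have := σ.diagRate_nonneg z
      linarith
    have h2 : ∑ z' ∈ Finset.univ.erase z,
        σ.stateExp n ((σ.totalRate (some z', some z) / b) • emptyPair z z')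
        ≤ ∑ z' ∈ Finset.univ.erase z, (σ.totalRate (some z', some z) / b) *
          (1 - (load M z + load M z') / b) ^ n := by
      refine Finset.sum_le_sum fun z' hz' => ?_
      rw [map_smul, smul_eq_mul]
      exact mul_le_mul_of_nonneg_left
        (σ.stateExp_emptyPair_le hb (Finset.ne_of_mem_erase hz').symm n)
        (div_nonneg (σ.totalRate_nonneg _) (Nat.cast_nonneg b))
    refine (add_le_add (mul_le_mul_of_nonneg_left ih h1) h2).trans_eq ?_
    simp only [Nat.add_sub_cancel]
    rw [mul_add, ← pow_succ', add_assoc, Finset.mul_sum, ← Finset.sum_add_distrib]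
    congr 1
    refine Finset.sum_congr rfl fun z' _ => ?_
    rw [Finset.sum_range_succ, Nat.sub_self, pow_zero, mul_one, mul_add, Finset.mul_sum,
      Finset.mul_sum, Finset.mul_sum]
    congr 1
    refine Finset.sum_congr rfl fun t ht => ?_
    rw [show n - t = (n - 1 - t) + 1 by have := Finset.mem_range.1 ht; omega, pow_succ']
    ring

/-! ### Integral rates and summation over the bins -/

theorem expectedAlg_eq_sum (hb : 0 < b) :
    σ.expectedAlg = ∑ z, (1 - σ.stateExp b (empty z)) := by
  rw [σ.expectedAlg_eq hb, ← stateExp_eq_iterate]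
  have h : (fun S : Finset Z => (S.card : ℝ)) = ∑ z, (1 - empty z) := by
    classical
    ext S
    simp only [Finset.sum_apply, Pi.sub_apply, Pi.one_apply, empty]
    have : ∀ z, (1 - if z ∈ S then (0 : ℝ) else 1) = if z ∈ S then 1 else 0 := by
      intro z; split_ifs <;> norm_num
    simp [this]
  rw [h, map_sum]
  simp_rw [map_sub, σ.stateExp_one hb]

/-- For integral rates, an edge `(y, z)` contributes to `diagRate z` only if `y` has rate one and
more than half of its rate goes to `z`. -/
theorem pairRate_diag_le_of_integral (hb : 0 < b) (hG : ∀ y, ∃ n : ℕ, G.rate y = n) (y : Y)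
    (z : Z) : σ.pairRate y (some z, some z) ≤ 0 ∨
      (1 / 2 < M.frac y z ∧
        σ.pairRate y (some z, some z) ≤ 2 * (1 - (1 - 1 / (b : ℝ)) ^ b) - 1) := by
  have h := σ.pairRate_diag_le hb y z
  have h0 : M.frac y z ≤ G.rate y :=
    (Finset.single_le_sum (fun z _ => M.frac_nonneg y z) (Finset.mem_univ z)).trans
      (M.sum_frac_le_rate hb y)
  have h1 : M.frac y z ≤ 1 :=
    (Finset.single_le_sum (fun y _ => M.frac_nonneg y z) (Finset.mem_univ y)).trans
      (M.sum_frac_le_one hb z)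
  obtain ⟨n, hn⟩ := hG y
  by_cases hle : 2 * M.frac y z - G.rate y ≤ 0
  · exact Or.inl (by rwa [max_eq_left hle] at h)
  · push Not at hle
    rw [max_eq_right hle.le] at h
    -- From 2f > n and f ≤ 1 follows n < 2; from 2f > n and f ≤ n follows n > 0.
    have hn1 : n = 1 := by
      have h2 : (n : ℝ) < 2 := by linarith
      have h3 : (0 : ℝ) < n := by linarith
      have h4 : n < 2 := by exact_mod_cast h2
      have h5 : 0 < n := by exact_mod_cast h3
      omega
    have h6 := M.frac_le hb y z
    rw [hn, hn1, Nat.cast_one] at hle h h6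
    exact Or.inr ⟨by linarith, by linarith⟩

theorem diagRate_le_of_integral (hb : 0 < b) (hG : ∀ y, ∃ n : ℕ, G.rate y = n) (z : Z) :
    σ.diagRate z = 0 ∨ (1 / 2 ≤ load M z ∧
      σ.diagRate z ≤ 2 * (1 - (1 - 1 / (b : ℝ)) ^ b) - 1) := by
  classical
  by_cases h : ∀ y, σ.pairRate y (some z, some z) ≤ 0
  · exact Or.inl (le_antisymm (Finset.sum_nonpos fun y _ => h y) (σ.diagRate_nonneg z))
  · push Not at h
    obtain ⟨y, hy⟩ := h
    obtain ⟨h1, h2⟩ :=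
      (σ.pairRate_diag_le_of_integral hb hG y z).resolve_left (not_le.2 hy)
    refine Or.inr ⟨h1.le.trans (Finset.single_le_sum (f := fun y => M.frac y z)
      (fun y _ => M.frac_nonneg y z) (Finset.mem_univ y)), le_trans ?_ h2⟩
    rw [diagRate, totalRate, ← Finset.sum_erase_add _ _ (Finset.mem_univ y)]
    refine add_le_of_nonpos_left (Finset.sum_nonpos fun y' hy' => ?_)
    -- Two types each sending more than 1/2 to z would exceed the load bound 1, so a single type
    -- accounts for the whole diagonal rate.
    refine (σ.pairRate_diag_le_of_integral hb hG y' z).resolve_right fun h3 => ?_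
    have h4 := M.sum_frac_le_one hb z
    have h5 : ∑ y'' ∈ {y', y}, M.frac y'' z ≤ ∑ y'', M.frac y'' z :=
      Finset.sum_le_sum_of_subset_of_nonneg (Finset.subset_univ _)
        fun y _ _ => M.frac_nonneg y z
    rw [Finset.sum_pair (Finset.ne_of_mem_erase hy')] at h5
    linarith [h3.1]

/-- The products of decay factors of two bins, relaxed to a function that is linear in one of the
loads. -/
theorem exp_add_le_linear {a a' : ℝ} (ha : a ≤ 1) (h0 : 0 ≤ a') (h1 : a' ≤ 1) :
    Real.exp (-(a + a')) ≤ Real.exp (-a) - 0.232 * a' := by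
  have he := exp_neg_one_bounds
  have h2 := convexOn_exp.2 (Set.mem_univ 0) (Set.mem_univ (-1)) (by linarith : 0 ≤ 1 - a') h0
    (by ring)
  simp only [smul_eq_mul, mul_zero, zero_add, Real.exp_zero, mul_one, mul_neg] at h2
  have h3 : Real.exp (-1) ≤ Real.exp (-a) := Real.exp_le_exp.2 (by linarith)
  have h4 : 0.632 * a' ≤ 1 - Real.exp (-a') := by
    have := mul_le_mul_of_nonneg_left he.2 h0
    norm_num at *
    linarith
  rw [neg_add, Real.exp_add]
  -- 0.232 is 0.3678 · 0.632 rounded down.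
  have h5 := mul_le_mul (he.1.trans h3) h4 (by positivity) (Real.exp_pos _).le
  norm_num at *
  linarith

open Classical in
-- Half of the linear bound contributes -0.116 a(z'), written as -0.116 + 0.116 (1 - a(z')) so that
-- the factors of λ stay nonnegative and upper bounds on its row and column sums suffice. The error
-- 10/b is at most 0.0005.
theorem stateExp_empty_le_of_large (hb : 20000 ≤ b) (z : Z) :
    σ.stateExp b (empty z) ≤ Real.exp (-load M z) ^ 2 * Real.exp (σ.diagRate z)
      + (load M z - σ.diagRate z) *
        ((Real.exp (-load M z) ^ 2 * Real.exp (σ.diagRate z) + Real.exp (-load M z)) / 2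
          + 0.0005 - 0.116)
      + ∑ z' ∈ Finset.univ.erase z, σ.totalRate (some z', some z) *
        (0.116 * (1 - load M z')) := by
  have hb0 : 0 < b := by omega
  have hbr : (20000 : ℝ) ≤ b := by exact_mod_cast hb
  have ha0 := load_nonneg (M := M) z
  have ha1 := load_le_one (M := M) hb0 z
  have hs0 := σ.diagRate_nonneg z
  have hsa := σ.diagRate_le_load hb0 z
  have hc : Real.exp (-(2 * load M z - σ.diagRate z))
      = Real.exp (-load M z) ^ 2 * Real.exp (σ.diagRate z) := by
    rw [← Real.exp_nat_mul, ← Real.exp_add]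
    congr 1
    push_cast
    ring
  have h1 := σ.stateExp_empty_le (by omega) z b
  have h2 : (1 - (2 * load M z - σ.diagRate z) / b) ^ b
      ≤ Real.exp (-load M z) ^ 2 * Real.exp (σ.diagRate z) := by
    rw [← hc]
    exact Real.one_sub_div_pow_le_exp_neg (by linarith)
  set X := Real.exp (-load M z) ^ 2 * Real.exp (σ.diagRate z) with hX
  have h3 : ∀ z' ∈ Finset.univ.erase z, (σ.totalRate (some z', some z) / b) *
        ∑ t ∈ Finset.range b, (1 - (load M z + load M z') / b) ^ t *
          (1 - (2 * load M z - σ.diagRate z) / b) ^ (b - 1 - t)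
      ≤ σ.totalRate (some z', some z) * ((X + Real.exp (-load M z)) / 2 + 0.0005 - 0.116)
        + σ.totalRate (some z', some z) * (0.116 * (1 - load M z')) := by
    intro z' _
    have ha0' := load_nonneg (M := M) z'
    have ha1' := load_le_one (M := M) hb0 z'
    have h4 := geom_sum_le (b := b) (by omega) (c := 2 * load M z - σ.diagRate z)
      (m := load M z + load M z') (by linarith) (by linarith) (by linarith) (by linarith)
    rw [hc] at h4
    have h5 := exp_add_le_linear ha1 ha0' ha1'
    have h6 : (10 : ℝ) / b ≤ 0.0005 := by
      rw [div_le_iff₀ (by linarith)]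
      norm_num
      linarith
    rw [div_mul_eq_mul_div, mul_div_assoc, ← mul_add]
    refine mul_le_mul_of_nonneg_left (h4.trans ?_) (σ.totalRate_nonneg _)
    linarith
  have h7 := (Finset.sum_le_sum h3).trans_eq Finset.sum_add_distrib
  rw [← Finset.sum_mul] at h7
  have h8 : 0 ≤ (X + Real.exp (-load M z)) / 2 + 0.0005 - 0.116 := by
    have h9 : Real.exp (-1) ≤ Real.exp (-load M z) := Real.exp_le_exp.2 (by linarith)
    have h10 := exp_neg_one_bounds.1
    have h11 : 0 ≤ X := by positivity
    norm_num at h10 ⊢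
    linarith
  have h12 := mul_le_mul_of_nonneg_right (σ.sum_totalRate_erase_second hb0 z) h8
  linarith

/-- The bound `hb1` on (1 - 1/b)^b turns the estimate of a nonzero diagonal rate into s ≤ 0.2645. -/
theorem bin_bound (hb : 0 < b) (hG : ∀ y, ∃ n : ℕ, G.rate y = n)
    (hb1 : 0.36775 ≤ (1 - 1 / (b : ℝ)) ^ b) (z : Z) :
    0.705 * load M z ≤ 1 - Real.exp (-load M z) ^ 2 * Real.exp (σ.diagRate z)
      - (load M z - σ.diagRate z) *
        ((Real.exp (-load M z) ^ 2 * Real.exp (σ.diagRate z) + Real.exp (-load M z)) / 2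
          - 0.116 * load M z + 0.0005) := by
  have ha0 := load_nonneg (M := M) z
  have ha1 := load_le_one (M := M) hb z
  rcases σ.diagRate_le_of_integral hb hG z with h | ⟨h1, h2⟩
  · simpa [h] using bin_bound_zero ha0 ha1
  · exact bin_bound_of_half_le h1 ha1 (σ.diagRate_nonneg z)
      (h2.trans (by norm_num at hb1 ⊢; linarith))

theorem le_expectedAlg (hb : 20000 ≤ b) (hG : ∀ y, ∃ n : ℕ, G.rate y = n)
    (hb1 : 0.36775 ≤ (1 - 1 / (b : ℝ)) ^ b) : 0.705 * M.expectedOpt ≤ σ.expectedAlg := by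
  classical
  have hb0 : 0 < b := by omega
  rw [σ.expectedAlg_eq_sum hb0, M.expectedOpt_eq_sum_frac, Finset.mul_sum]
  have h1 := Finset.sum_le_sum fun z (_ : z ∈ Finset.univ) => σ.stateExp_empty_le_of_large hb z
  have h2 := Finset.sum_le_sum fun z (_ : z ∈ Finset.univ) => σ.bin_bound hb0 hG hb1 z
  -- The decoupling: after exchanging the sums, the cost 0.116 (1 - a(z')) is weighted by the rate
  -- of balls with first priority z' and a different bin as second, which is at most a(z') - s(z').
  have h3 : ∑ z, ∑ z' ∈ Finset.univ.erase z, σ.totalRate (some z', some z) *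
        (0.116 * (1 - load M z'))
      ≤ ∑ z, (load M z - σ.diagRate z) * (0.116 * (1 - load M z)) := by
    rw [Finset.sum_comm' (t' := Finset.univ) (s' := fun z' => Finset.univ.erase z')
      (by simp [eq_comm])]
    refine Finset.sum_le_sum fun z _ => ?_
    rw [← Finset.sum_mul]
    refine mul_le_mul_of_nonneg_right (σ.sum_totalRate_erase_first hb0 z) ?_
    have := load_le_one (M := M) hb0 z
    exact mul_nonneg (by norm_num) (by linarith)
  have h4 : ∀ z, 1 - Real.exp (-load M z) ^ 2 * Real.exp (σ.diagRate z)
      - (load M z - σ.diagRate z) *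
        ((Real.exp (-load M z) ^ 2 * Real.exp (σ.diagRate z) + Real.exp (-load M z)) / 2
          - 0.116 * load M z + 0.0005)
      = 1 - (Real.exp (-load M z) ^ 2 * Real.exp (σ.diagRate z)
      + (load M z - σ.diagRate z) *
        ((Real.exp (-load M z) ^ 2 * Real.exp (σ.diagRate z) + Real.exp (-load M z)) / 2
          + 0.0005 - 0.116)) - (load M z - σ.diagRate z) * (0.116 * (1 - load M z)) := by
    intro z; ring
  simp_rw [h4] at h2
  rw [Finset.sum_sub_distrib, Finset.sum_sub_distrib] at h2
  rw [Finset.sum_add_distrib] at h1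
  rw [Finset.sum_sub_distrib]
  refine h2.trans ?_
  linarith

end EdgeOrder
end OfflineOpt

theorem eventually_le_one_sub_inv_pow :
    ∀ᶠ b : ℕ in Filter.atTop, 0.36775 ≤ (1 - 1 / (b : ℝ)) ^ b := by
  have h := Real.tendsto_one_add_div_pow_exp (-1)
  have h1 : (0.36775 : ℝ) < Real.exp (-1) := by
    rw [Real.exp_neg, lt_inv_comm₀ (by norm_num) (Real.exp_pos 1)]
    exact Real.exp_one_lt_d9.trans (by norm_num)
  filter_upwards [h.eventually (lt_mem_nhds h1)] with b hb
  rw [neg_div, ← sub_eq_add_neg] at hb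
  exact hb.le

end StochasticMatching
end

theorem mainTheorem2 :
    ∃ b₀ : ℕ, ∀ b : ℕ, b₀ ≤ b →
      ∀ (Y Z : Type*) [Fintype Y] [Fintype Z] (G : StochasticMatching Y Z b),
        (∀ y, ∃ n : ℕ, G.rate y = n) →
        ∀ (M : G.OfflineOpt) (σ : M.EdgeOrder),
          0 < M.expectedOpt → (0.705 : ℝ) ≤ σ.competitiveRatio := by
  obtain ⟨b₁, h₁⟩ := Filter.eventually_atTop.1 StochasticMatching.eventually_le_one_sub_inv_pow
  refine ⟨max b₁ 20000, fun b hb Y Z _ _ G hG M σ hM => ?_⟩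
  rw [StochasticMatching.OfflineOpt.EdgeOrder.competitiveRatio, le_div_iff₀ hM]
  exact σ.le_expectedAlg ((le_max_right _ _).trans hb) hG (h₁ b ((le_max_left _ _).trans hb))
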